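/- Let $\rho\in\mathbb{R}$, let $M^3(\rho)$ be the simply connected $3$-dimensional Riemannian space form of constant curvature $\rho$, let $\{R_t\}$ be the group of rotations of $M^3(\rho)$ about a geodesic (the axis), and let $B(\rho)\subset M^3(\rho)$ be a totally geodesic surface that contains the axis. Let $S$ be a smoothly immersed rotational torus in $M^3(\rho)$, that is, a torus with an immersion $f:\mathbb{R}^2\to M^3(\rho)$ such that $f(u,v+t)=R_t f(u,v)$ and $f(u+L,v+\alpha)=f(u,v)$ for some $L>0$, $\alpha\in\mathbb{R}$. Its profile curve $\gamma$ is the curve in which $S$ meets the half of $B(\rho)$ on one side of the axis: $\gamma(u)$ is the point of this half on the orbit of $f(u,0)$. Let $\kappa_1$ and $\kappa_2$ be the principal curvatures of $S$ in the direction orthogonal to the orbits of the rotations and in the direction of the orbits, respectively, and let $\kappa$ be the signed geodesic curvature of $\gamma$ in $B(\rho)$; the unit normals $\eta$ of $S$ and $N$ of $\gamma$ in $B(\rho)$ are chosen so that $\eta=-N$ along $\gamma$. Suppose that $S$ is non-isoparametric ($\kappa_1$ and $\kappa_2$ are not both constant) and that $W(\kappa_1,\kappa_2)=0$ along $S$,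 for a function $W:\mathbb{R}^2\to\mathbb{R}$. Then $\gamma$ is a smooth regular closed curve which is planar (it lies in $B(\rho)$), and it is locally a critical curve of a curvature energy, in the following sense. Let $\gamma(u_0)$ be a point of $\gamma$ at which the derivative of $\kappa$ is not zero; if $\kappa$ is constant, let it be any point of $\gamma$. Then there are $a<u_0<b$ and a smooth function $P$ on an open set containing $\kappa([a,b])$ such that, for all $x\in\kappa([a,b])$, with $\dot P=dP/dx$, $$\dot P(x)\neq 0,\qquad W\left(-x,\ \frac{P(x)}{\dot P(x)}-x\right)=0,$$ and the arc $\gamma|_{[a,b]}$ is a critical point of $$\mathbf{\Theta}(\gamma)=\int_\gamma P(\kappa)\,ds$$ among curves in $B(\rho)$: for every smooth variation $\Gamma_\varepsilon$ of $\gamma$ through curves in $B(\rho)$ with $\Gamma_\varepsilon(u)=\gamma(u)$ for $u\notin(a,b)$, the derivative of $\mathbf{\Theta}(\Gamma_\varepsilon|_{[a,b]})$ at $\varepsilon=0$ exists and is zero. -/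

import Mathlib

open scoped ContDiff

namespace SpaceForm

noncomputable section

/-- Ambient vector space of the models of the space forms; the coordinates are `x, y, z, w`. -/
abbrev V : Type := Fin 4 → ℝ

/-- The bilinear form `x x' + y y' + z z' + w w' / ρ`. For `ρ = 0` the last term is absent
(`0⁻¹ = 0` in Lean). -/
def ip (ρ : ℝ) (X Y : V) : ℝ :=
  X 0 * Y 0 + X 1 * Y 1 + X 2 * Y 2 + ρ⁻¹ * (X 3 * Y 3)

/-- The simply connected `3`-dimensional space form of curvature `ρ`: the quadric
`ρ (x² + y² + z²) + w² = 1` (its sheet `w > 0` if `ρ ≤ 0`) with the Riemannian metric induced by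
`ip ρ`. In the coordinates `(x, y, z, w / √|ρ|)` this is the round sphere of radius `1 / √ρ` for
`ρ > 0` and the hyperboloid model for `ρ < 0`; for `ρ = 0` it is the Euclidean space `w = 1`. -/
def M (ρ : ℝ) : Set V :=
  {p | ρ * (p 0 ^ 2 + p 1 ^ 2 + p 2 ^ 2) + p 3 ^ 2 = 1 ∧ (ρ ≤ 0 → 0 < p 3)}

/-- The totally geodesic surface `y = 0` of `M ρ`; it contains the rotation axis `x = y = 0`. -/
def B (ρ : ℝ) : Set V :=
  {p | p ∈ M ρ ∧ p 1 = 0}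

/-- The vector product of two tangent vectors `X, Y` of `M ρ` at `p`: the tangent vector `Z` with
`ip ρ Z U = vol (X, Y, U)` for all tangent vectors `U` at `p`, where the Riemannian volume form of
`M ρ` at `p` is `vol (X, Y, U) = det (X, Y, U, p)`. -/
def cross (ρ : ℝ) (p X Y : V) : V := fun i =>
  (if i = 3 then ρ else 1) * Matrix.det (Matrix.of ![X, Y, Pi.single i 1, p])

/-- The group of rotations of `M ρ` about the geodesic `x = y = 0`. -/
def rot (t : ℝ) (p : V) : V :=
  ![Real.cos t * p 0 - Real.sin t * p 1, Real.sin t * p 0 + Real.cos t * p 1, p 2, p 3]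

/-! ### Parametrized surfaces -/

/-- Partial derivative with respect to the first variable. -/
def pu (f : ℝ × ℝ → V) (q : ℝ × ℝ) : V := deriv (fun s => f (s, q.2)) q.1

/-- Partial derivative with respect to the second variable. -/
def pv (f : ℝ × ℝ → V) (q : ℝ × ℝ) : V := deriv (fun t => f (q.1, t)) q.2

/-- A (smoothly immersed) rotational torus in `M ρ`: an immersion of the plane into `M ρ`,
equivariant under the rotation group, which is the lift of an immersion of the torus
`ℝ² / (ℤ (L, α) + ℤ (0, 2π))` (the period `(0, 2π)` is a consequence of equivariance). -/
structure IsRotationalTorus (ρ : ℝ) (f : ℝ × ℝ → V) : Prop where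
  smooth : ContDiff ℝ ∞ f
  mem : ∀ q, f q ∈ M ρ
  immersion : ∀ q, LinearIndependent ℝ ![pu f q, pv f q]
  invariant : ∀ u v t, f (u, v + t) = rot t (f (u, v))
  closed : ∃ L : ℝ, 0 < L ∧ ∃ α : ℝ, ∀ u v, f (u + L, v + α) = f (u, v)

/-- The unit normal `η` in the direction of `f_u × f_v`. -/
def normal (ρ : ℝ) (f : ℝ × ℝ → V) (q : ℝ × ℝ) : V :=
  (Real.sqrt (ip ρ (cross ρ (f q) (pu f q) (pv f q)) (cross ρ (f q) (pu f q) (pv f q))))⁻¹ •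
    cross ρ (f q) (pu f q) (pv f q)

/-- `X = a f_u + b f_v` is a nonzero principal vector at `f q` with principal curvature `k`, that is
`II (X, ·) = k I (X, ·)`. Here `I` is the induced metric and `II (X, Y) = ip ρ (∇_X Y) η`. The
ambient second derivatives of `f` may be used for `∇_X Y`, since they differ from the covariant
derivatives in `M ρ` by multiples of the position vector, to which `η` is orthogonal. -/
def IsPrincipalVector (ρ : ℝ) (f : ℝ × ℝ → V) (q : ℝ × ℝ) (a b k : ℝ) : Prop :=
  (a ≠ 0 ∨ b ≠ 0) ∧
  a * ip ρ (pu (pu f) q) (normal ρ f q) + b * ip ρ (pv (pu f) q) (normal ρ f q)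
    = k * (a * ip ρ (pu f q) (pu f q) + b * ip ρ (pu f q) (pv f q)) ∧
  a * ip ρ (pv (pu f) q) (normal ρ f q) + b * ip ρ (pv (pv f) q) (normal ρ f q)
    = k * (a * ip ρ (pu f q) (pv f q) + b * ip ρ (pv f q) (pv f q))

/-- `k` is the principal curvature `κ₁` of the rotational surface `f` at `q`: the one whose principal
direction is orthogonal to the orbit of the rotations. -/
def IsKappa₁ (ρ : ℝ) (f : ℝ × ℝ → V) (q : ℝ × ℝ) (k : ℝ) : Prop :=
  ∃ a b : ℝ, ip ρ (a • pu f q + b • pv f q) (pv f q) = 0 ∧ IsPrincipalVector ρ f q a b k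

/-- `k` is the principal curvature `κ₂` of the rotational surface `f` at `q`: the one whose principal
direction is tangent to the orbit of the rotations. -/
def IsKappa₂ (ρ : ℝ) (f : ℝ × ℝ → V) (q : ℝ × ℝ) (k : ℝ) : Prop :=
  IsPrincipalVector ρ f q 0 1 k

/-- The relation `W (κ₁, κ₂) = 0` holds along the surface. -/
def IsWeingarten (ρ : ℝ) (f : ℝ × ℝ → V) (W : ℝ → ℝ → ℝ) : Prop :=
  ∀ q k₁ k₂, IsKappa₁ ρ f q k₁ → IsKappa₂ ρ f q k₂ → W k₁ k₂ = 0

/-- Both principal curvatures are constant. -/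
def IsIsoparametric (ρ : ℝ) (f : ℝ × ℝ → V) : Prop :=
  ∃ c₁ c₂ : ℝ, ∀ q, IsKappa₁ ρ f q c₁ ∧ IsKappa₂ ρ f q c₂

/-- The profile curve of a rotational surface: the point in which the orbit of `f (u, 0)` meets the
half `{y = 0, x ≥ 0}` of the totally geodesic surface `B ρ`. -/
def profile (f : ℝ × ℝ → V) (u : ℝ) : V :=
  ![Real.sqrt (f (u, 0) 0 ^ 2 + f (u, 0) 1 ^ 2), 0, f (u, 0) 2, f (u, 0) 3]

/-! ### Curves in the totally geodesic surface -/

/-- The speed of a curve. -/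
def speed (ρ : ℝ) (γ : ℝ → V) (u : ℝ) : ℝ := Real.sqrt (ip ρ (deriv γ u) (deriv γ u))

/-- A smooth regular closed curve of period `L` which is planar: it lies in the totally geodesic
surface `B ρ`. -/
structure IsPlanarClosedCurve (ρ L : ℝ) (γ : ℝ → V) : Prop where
  smooth : ContDiff ℝ ∞ γ
  planar : ∀ u, γ u ∈ B ρ
  regular : ∀ u, 0 < speed ρ γ u
  closed : ∀ u, γ (u + L) = γ u

/-- The unit normal `N = B × T` in `B ρ` of a curve in `B ρ`, where `T` is the unit tangent and the
binormal `B` is the constant unit normal `(0, 1, 0, 0)` of `B ρ`. -/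
def conormal (ρ : ℝ) (γ : ℝ → V) (u : ℝ) : V :=
  (speed ρ γ u)⁻¹ • cross ρ (γ u) (Pi.single 1 1) (deriv γ u)

/-- The (signed) geodesic curvature `κ = ip ρ (∇_T T) N` in `B ρ` of a curve in `B ρ`, in an
arbitrary regular parametrization. -/
def curvature (ρ : ℝ) (γ : ℝ → V) (u : ℝ) : ℝ :=
  ip ρ (deriv (deriv γ) u) (conormal ρ γ u) / speed ρ γ u ^ 2

/-- The curvature energy `∫ P(κ) ds` of the arc of `γ` over `[a, b]`. -/
def energy (ρ : ℝ) (P : ℝ → ℝ) (γ : ℝ → V) (a b : ℝ) : ℝ :=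
  ∫ u in a..b, P (curvature ρ γ u) * speed ρ γ u

/-- Smooth variations in `B ρ` of the curve `γ` that fix `γ` outside the arc over `(a, b)`; the first
variable is the variation parameter. -/
structure IsVariation (ρ : ℝ) (γ : ℝ → V) (a b : ℝ) (Γ : ℝ × ℝ → V) : Prop where
  smooth : ContDiff ℝ ∞ Γ
  mem : ∀ q, Γ q ∈ B ρ
  zero : ∀ u, Γ (0, u) = γ u
  fixed : ∀ ε u, u ∉ Set.Ioo a b → Γ (ε, u) = γ u

/-- The arc of `γ` over `[a, b]` is critical for the energy `∫ P(κ) ds` among curves in `B ρ`. -/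
def IsCriticalArc (ρ : ℝ) (P : ℝ → ℝ) (γ : ℝ → V) (a b : ℝ) : Prop :=
  ∀ Γ : ℝ × ℝ → V, IsVariation ρ γ a b Γ →
    HasDerivAt (fun ε => energy ρ P (fun u => Γ (ε, u)) a b) 0 0

end

end SpaceForm

/-! Let `α`, `τ`, `β` be the `x`-coordinates of `γ`, of its unit tangent `T` and of its conormal
`N`. Here `α` is the radius of the orbit, positive because `f` is an immersion. The Frenet equations
of the moving frame, read in one coordinate, are `α_s = τ`, `τ_s = κ β - ρ α`, `β_s = -κ τ`.
Computing the second fundamental form gives `κ₁ = -κ` and `κ₂ = β / α`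
(`IsRotationalTorus.isKappa₁`, `IsRotationalTorus.isKappa₂`).

The Euler-Lagrange equation of `∫ P(κ) ds` is `Ṗ_ss + (κ² + ρ) Ṗ - κ P = 0`. By the Frenet equations
it holds as soon as `Ṗ(κ) = α` and `P(κ) = β + κ α`. These two requirements are compatible, since
`(β + κ α)_s = κ_s α`. Where `κ' ≠ 0` the curvature is a local coordinate, so `P` exists
(`exists_contDiffOn_comp_eq`). Then `P / Ṗ - κ = β / α = κ₂`, and the relation for `P` is the
Weingarten relation itself.

If `κ` is constant, `P(x) = x + μ` is critical exactly when `κ μ = ρ`. The periodic function `τ` has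
a critical point, where `κ β = ρ α`, and `μ` is the value of `κ₂` there
(`IsRotationalTorus.exists_curvature_mul_eq`).

Both cases use one first variation formula, `IsPlanarClosedCurve.isCriticalArc`, stated for any
solution `α, τ, β` of the linear system. -/

namespace SpaceForm

/-! ### Linear algebra of the tangent planes of `B ρ`, uniformly in the sign of `ρ` -/

section Algebra

variable {ρ : ℝ}

/-- The vector product with the unit normal `(0, 1, 0, 0)` of `B ρ`. -/
def planarCross (ρ : ℝ) (p X : V) : V :=
  ![X 2 * p 3 - X 3 * p 2, 0, X 3 * p 0 - X 0 * p 3, ρ * (X 0 * p 2 - X 2 * p 0)]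

/-- `X` is tangent to `B ρ` at `p`. -/
def IsTangent (ρ : ℝ) (p X : V) : Prop :=
  X 1 = 0 ∧ ρ * (p 0 * X 0 + p 2 * X 2) + p 3 * X 3 = 0

theorem ip_comm (X Y : V) : ip ρ X Y = ip ρ Y X := by simp only [ip]; ring

theorem ip_add_left (X Y Z : V) : ip ρ (X + Y) Z = ip ρ X Z + ip ρ Y Z := by
  simp only [ip, Pi.add_apply]; ring

theorem ip_smul_left (c : ℝ) (X Y : V) : ip ρ (c • X) Y = c * ip ρ X Y := by
  simp only [ip, Pi.smul_apply, smul_eq_mul]; ring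

theorem ip_add_right (X Y Z : V) : ip ρ X (Y + Z) = ip ρ X Y + ip ρ X Z := by
  simp only [ip, Pi.add_apply]; ring

theorem ip_smul_right (c : ℝ) (X Y : V) : ip ρ X (c • Y) = c * ip ρ X Y := by
  simp only [ip, Pi.smul_apply, smul_eq_mul]; ring

theorem ip_neg_right (X Y : V) : ip ρ X (-Y) = -ip ρ X Y := by
  simp only [ip, Pi.neg_apply]; ring

theorem ip_sub_right (X Y Z : V) : ip ρ X (Y - Z) = ip ρ X Y - ip ρ X Z := by
  simp only [ip, Pi.sub_apply]; ring

theorem planarCross_add (p X Y : V) :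
    planarCross ρ p (X + Y) = planarCross ρ p X + planarCross ρ p Y := by
  ext i; fin_cases i <;> simp [planarCross] <;> ring

theorem planarCross_sub (p X Y : V) :
    planarCross ρ p (X - Y) = planarCross ρ p X - planarCross ρ p Y := by
  ext i; fin_cases i <;> simp [planarCross] <;> ring

theorem planarCross_smul (c : ℝ) (p X : V) :
    planarCross ρ p (c • X) = c • planarCross ρ p X := by
  ext i; fin_cases i <;> simp [planarCross] <;> ring

theorem planarCross_smul_left (c : ℝ) (p X : V) :
    planarCross ρ (c • p) X = c • planarCross ρ p X := by
  ext i; fin_cases i <;> simp [planarCross] <;> ring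

theorem planarCross_self (p : V) : planarCross ρ p p = 0 := by
  ext i; fin_cases i <;> simp [planarCross, mul_comm]

theorem planarCross_swap (p X : V) : planarCross ρ p X = -planarCross ρ X p := by
  ext i; fin_cases i <;> simp only [planarCross] <;> simp only [Pi.neg_apply] <;> simp <;> ring_nf

theorem cross_eq_planarCross (p X : V) :
    cross ρ p (Pi.single 1 1) X = planarCross ρ p X := by
  ext i
  fin_cases i <;>
    (simp [cross, planarCross, Matrix.det_succ_row_zero, Fin.sum_univ_succ, Fin.succAbove,
      Pi.single_apply]; try ring_nf; try simp)

/-- Skew-symmetry of the triple product. For `ρ = 0` the form ignores the last coordinate, and the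
skew-symmetry relies on that coordinate being zero in both vectors. -/
theorem ip_planarCross_swap {p X Y : V} (hX : ρ = 0 → X 3 = 0) (hY : ρ = 0 → Y 3 = 0) :
    ip ρ X (planarCross ρ p Y) = -ip ρ Y (planarCross ρ p X) := by
  rcases eq_or_ne ρ 0 with h | h
  · simp [ip, planarCross, hX h, hY h, h]; ring
  · simp [ip, planarCross]; field_simp; ring

theorem coord_three_of_zero {p : V} (hp : p ∈ B ρ) (h : ρ = 0) : p 3 = 1 := by
  obtain ⟨⟨h1, h2⟩, -⟩ := hp
  have := h2 h.le
  subst h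
  nlinarith

theorem mem_B_eq {p : V} (hp : p ∈ B ρ) : ρ * (p 0 ^ 2 + p 2 ^ 2) + p 3 ^ 2 = 1 := by
  have h1 := hp.1.1
  rw [hp.2] at h1
  linarith

namespace IsTangent

variable {p X Y T : V}

theorem coord_three (hp : p ∈ B ρ) (hX : IsTangent ρ p X) (h : ρ = 0) : X 3 = 0 := by
  have := hX.2
  rw [coord_three_of_zero hp h] at this
  simpa [h] using this

/-- The last coordinate of a tangent vector is divisible by `ρ`. -/
theorem exists_coord (hp : p ∈ B ρ) (hX : IsTangent ρ p X) :
    ∃ c, X 3 = ρ * c ∧ p 0 * X 0 + p 2 * X 2 + p 3 * c = 0 := by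
  rcases eq_or_ne ρ 0 with h | h
  · refine ⟨-(p 0 * X 0 + p 2 * X 2), by simp [h, hX.coord_three hp h], ?_⟩
    rw [coord_three_of_zero hp h]; ring
  · refine ⟨ρ⁻¹ * X 3, by field_simp, ?_⟩
    have := hX.2
    field_simp
    linarith

/-- The factor `ρ` in the last coordinates absorbs `ρ⁻¹`, so that later identities become polynomial
and need no case `ρ = 0`. -/
theorem ip_eq {c d : ℝ} (hX : X 1 = 0) (hc : X 3 = ρ * c) (hd : Y 3 = ρ * d) :
    ip ρ X Y = X 0 * Y 0 + X 2 * Y 2 + ρ * c * d := by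
  rcases eq_or_ne ρ 0 with h | h
  · simp [ip, hX, h]
  · simp only [ip, hX, hc, hd]; field_simp; ring

theorem smul (c : ℝ) (hX : IsTangent ρ p X) : IsTangent ρ p (c • X) :=
  ⟨by simp [hX.1], by simp only [Pi.smul_apply, smul_eq_mul]; linear_combination c * hX.2⟩

theorem planarCross (p X : V) : IsTangent ρ p (planarCross ρ p X) :=
  ⟨by simp [SpaceForm.planarCross], by simp [SpaceForm.planarCross]; ring⟩

/-- The factor `ρ` matters: for `ρ = 0` the form drops the last coordinate, and `p` need not be
orthogonal to `X`. -/
theorem mul_ip_self (hX : IsTangent ρ p X) : ρ * ip ρ p X = 0 := by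
  have := hX.2
  rcases eq_or_ne ρ 0 with h | h
  · simp [h]
  · simp only [ip, hX.1]; field_simp; linarith

theorem ip_pos (hp : p ∈ B ρ) (hX : IsTangent ρ p X) (h0 : X ≠ 0) : 0 < ip ρ X X := by
  obtain ⟨c, hc, h⟩ := hX.exists_coord hp
  rw [ip_eq hX.1 hc hc]
  have hB := mem_B_eq hp
  have hne : ¬ (X 0 = 0 ∧ X 2 = 0 ∧ ρ * c = 0) := by
    rintro ⟨h1, h2, h3⟩
    apply h0
    ext i; fin_cases i <;> simp [h1, h2, hX.1, hc, h3]
  rcases lt_or_ge 0 ρ with hρ | hρ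
  · by_contra hcon
    have e1 : X 0 * X 0 = 0 := by nlinarith [mul_self_nonneg (X 0), mul_self_nonneg (X 2), mul_nonneg hρ.le (mul_self_nonneg c)]
    have e2 : X 2 * X 2 = 0 := by nlinarith [mul_self_nonneg (X 0), mul_self_nonneg (X 2), mul_nonneg hρ.le (mul_self_nonneg c)]
    have e3 : ρ * (c * c) = 0 := by nlinarith [mul_self_nonneg (X 0), mul_self_nonneg (X 2), mul_nonneg hρ.le (mul_self_nonneg c)]
    exact hne ⟨by simpa using e1, by simpa using e2, by simpa [hρ.ne'] using e3⟩
  · have hw := hp.1.2 hρ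
    -- Eliminating `p 3 * c` by tangency and `p 3 ^ 2` by the equation of the quadric leaves
    -- Lagrange's identity; for `ρ ≤ 0` both terms are nonnegative.
    have key : p 3 ^ 2 * (X 0 * X 0 + X 2 * X 2 + ρ * c * c)
        = X 0 ^ 2 + X 2 ^ 2 + (-ρ) * (p 0 * X 2 - p 2 * X 0) ^ 2 := by
      linear_combination (X 0 * X 0 + X 2 * X 2) * hB
        + ρ * (p 3 * c - p 0 * X 0 - p 2 * X 2) * h
    have hpos : 0 < X 0 ^ 2 + X 2 ^ 2 := by
      by_contra hcon
      have e1 : X 0 = 0 := by nlinarith [sq_nonneg (X 0), sq_nonneg (X 2)]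
      have e2 : X 2 = 0 := by nlinarith [sq_nonneg (X 0), sq_nonneg (X 2)]
      refine hne ⟨e1, e2, ?_⟩
      rw [e1, e2] at h
      have : c = 0 := by simpa [hw.ne'] using h
      simp [this]
    have : 0 < p 3 ^ 2 * (X 0 * X 0 + X 2 * X 2 + ρ * c * c) := by
      rw [key]
      have := mul_nonneg (neg_nonneg.2 hρ) (sq_nonneg (p 0 * X 2 - p 2 * X 0))
      linarith
    exact pos_of_mul_pos_right this (sq_nonneg _)

theorem planarCross_planarCross (hp : p ∈ B ρ) (hX : IsTangent ρ p X) :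
    SpaceForm.planarCross ρ p (SpaceForm.planarCross ρ p X) = -X := by
  have hB := mem_B_eq hp
  have h := hX.2
  ext i
  fin_cases i <;> simp [SpaceForm.planarCross, hX.1]
  · linear_combination (-X 0) * hB + p 0 * h
  · linear_combination (-X 2) * hB + p 2 * h
  · linear_combination (-X 3) * hB + p 3 * h

theorem ip_planarCross_planarCross (hp : p ∈ B ρ) (hX : IsTangent ρ p X) :
    ip ρ (SpaceForm.planarCross ρ p X) (SpaceForm.planarCross ρ p X) = ip ρ X X := by
  rw [ip_planarCross_swap (fun h => (IsTangent.planarCross p X).coord_three hp h)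
    (hX.coord_three hp), hX.planarCross_planarCross hp, ip_neg_right, neg_neg]

theorem ip_self_planarCross (hp : p ∈ B ρ) (hX : IsTangent ρ p X) :
    ip ρ X (SpaceForm.planarCross ρ p X) = 0 := by
  have := ip_planarCross_swap (p := p) (hX.coord_three hp) (hX.coord_three hp)
  linarith

/-- A unit tangent vector and its rotation form an orthonormal frame. -/
theorem eq_frame (hp : p ∈ B ρ) (hX : IsTangent ρ p X) (hT : IsTangent ρ p T)
    (h1 : ip ρ T T = 1) :
    X = ip ρ X T • T + ip ρ X (SpaceForm.planarCross ρ p T) • SpaceForm.planarCross ρ p T := by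
  obtain ⟨c, hc, h⟩ := hX.exists_coord hp
  obtain ⟨t, ht, h'⟩ := hT.exists_coord hp
  have hB := mem_B_eq hp
  rw [ip_eq hT.1 ht ht] at h1
  have hN : SpaceForm.planarCross ρ p T 3 = ρ * (T 0 * p 2 - T 2 * p 0) := by
    simp [SpaceForm.planarCross]
  rw [ip_eq hX.1 hc ht, ip_eq hX.1 hc hN]
  set n := T 0 * p 2 - T 2 * p 0 with hn
  set b := X 0 * SpaceForm.planarCross ρ p T 0 + X 2 * SpaceForm.planarCross ρ p T 2 + ρ * c * n
    with hb
  have hN0 : SpaceForm.planarCross ρ p T 0 = T 2 * p 3 - ρ * t * p 2 := by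
    simp [SpaceForm.planarCross, ht]
  have hN2 : SpaceForm.planarCross ρ p T 2 = ρ * t * p 0 - T 0 * p 3 := by
    simp [SpaceForm.planarCross, ht]
  have hN1 : SpaceForm.planarCross ρ p T 1 = 0 := by simp [SpaceForm.planarCross]
  rw [hN0, hN2] at hb
  -- In the coordinates `(0, 2, c)`, both `X` and `T` are annihilated by the covector `(p 0, p 2, p
  -- 3)`, so their vector product is a multiple of it; the factor is the conormal component `b`.
  have e0 : X 2 * t - c * T 2 = b * p 0 := by
    rw [hb, hn]
    linear_combination (-(X 2 * t - c * T 2)) * hB + (ρ * p 2 * t - p 3 * T 2) * h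
      + (p 3 * X 2 - ρ * p 2 * c) * h'
  have e1 : c * T 0 - X 0 * t = b * p 2 := by
    rw [hb, hn]
    linear_combination (-(c * T 0 - X 0 * t)) * hB + (p 3 * T 0 - ρ * p 0 * t) * h
      + (ρ * p 0 * c - p 3 * X 0) * h'
  have e2 : X 0 * T 2 - X 2 * T 0 = b * p 3 := by
    rw [hb, hn]
    linear_combination (-(X 0 * T 2 - X 2 * T 0)) * hB + (ρ * p 0 * T 2 - ρ * p 2 * T 0) * h
      + (ρ * p 2 * X 0 - ρ * p 0 * X 2) * h'
  ext i
  fin_cases i <;>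
    simp only [Fin.zero_eta, Fin.mk_one, Fin.reduceFinMk, Pi.add_apply, Pi.smul_apply, smul_eq_mul,
      hN0, hN1, hN2, hN, hX.1, hT.1, ht, hc]
  · linear_combination (-X 0) * h1 + T 2 * e2 - ρ * t * e1
  · ring
  · linear_combination (-X 2) * h1 - T 0 * e2 + ρ * t * e0
  · linear_combination (-ρ * c) * h1 + ρ * T 0 * e1 - ρ * T 2 * e0

/-- The vector product of a tangent vector and its rotation is the multiple `ρ p` of the position. -/
theorem planarCross_frame (hp : p ∈ B ρ) (hT : IsTangent ρ p T) (h1 : ip ρ T T = 1) :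
    SpaceForm.planarCross ρ T (SpaceForm.planarCross ρ p T) = ρ • p := by
  obtain ⟨t, ht, h'⟩ := hT.exists_coord hp
  have hB := mem_B_eq hp
  rw [ip_eq hT.1 ht ht] at h1
  have hp1 := hp.2
  ext i
  fin_cases i <;> simp [SpaceForm.planarCross, ht, hp1]
  · linear_combination ρ * p 0 * h1 - ρ * T 0 * h'
  · linear_combination ρ * p 2 * h1 - ρ * T 2 * h'
  · left; linear_combination p 3 * h1 - ρ * t * h'

end IsTangent

end Algebra
-- Derivatives of the inner and vector products
section Calculus

variable {ρ : ℝ}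

theorem ip_hasDerivAt {X Y : ℝ → V} {X' Y' : V} {u : ℝ} (hX : HasDerivAt X X' u)
    (hY : HasDerivAt Y Y' u) :
    HasDerivAt (fun s => ip ρ (X s) (Y s)) (ip ρ X' (Y u) + ip ρ (X u) Y') u := by
  rw [hasDerivAt_pi] at hX hY
  have := ((((hX 0).mul (hY 0)).add ((hX 1).mul (hY 1))).add ((hX 2).mul (hY 2))).add
    (((hX 3).mul (hY 3)).const_mul ρ⁻¹)
  convert! this using 1
  simp only [ip]; ring

theorem planarCross_hasDerivAt {X Y : ℝ → V} {X' Y' : V} {u : ℝ} (hX : HasDerivAt X X' u)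
    (hY : HasDerivAt Y Y' u) :
    HasDerivAt (fun s => planarCross ρ (X s) (Y s))
      (planarCross ρ X' (Y u) + planarCross ρ (X u) Y') u := by
  rw [hasDerivAt_pi] at hX hY ⊢
  intro i
  fin_cases i <;> simp only [planarCross]
  · convert! ((hY 2).mul (hX 3)).sub ((hY 3).mul (hX 2)) using 1
    simp; ring
  · convert! hasDerivAt_const u (0 : ℝ) using 1
    simp
  · convert! ((hY 3).mul (hX 0)).sub ((hY 0).mul (hX 3)) using 1
    simp; ring
  · convert! (((hY 0).mul (hX 2)).sub ((hY 2).mul (hX 0))).const_mul ρ using 1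
    simp; ring

variable {E : Type*} [NormedAddCommGroup E] [NormedSpace ℝ E] {n : WithTop ℕ∞}

theorem ip_contDiff {X Y : E → V} (hX : ContDiff ℝ n X) (hY : ContDiff ℝ n Y) :
    ContDiff ℝ n (fun s => ip ρ (X s) (Y s)) := by
  rw [contDiff_pi] at hX hY
  have h0 := hX 0; have h1 := hX 1; have h2 := hX 2; have h3 := hX 3
  have k0 := hY 0; have k1 := hY 1; have k2 := hY 2; have k3 := hY 3
  simp only [ip]
  fun_prop

theorem planarCross_contDiff {X Y : E → V} (hX : ContDiff ℝ n X) (hY : ContDiff ℝ n Y) :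
    ContDiff ℝ n (fun s => planarCross ρ (X s) (Y s)) := by
  rw [contDiff_pi] at hX hY ⊢
  have h0 := hX 0; have h1 := hX 1; have h2 := hX 2; have h3 := hX 3
  have k0 := hY 0; have k1 := hY 1; have k2 := hY 2; have k3 := hY 3
  intro i
  fin_cases i <;> simp [planarCross] <;> fun_prop

theorem isTangent_of_hasDerivAt {γ : ℝ → V} {X : V} {u : ℝ} (hB : ∀ s, γ s ∈ B ρ)
    (h : HasDerivAt γ X u) : IsTangent ρ (γ u) X := by
  rw [hasDerivAt_pi] at h
  constructor
  · have h1 := h 1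
    rw [show (fun s => γ s 1) = fun _ => (0 : ℝ) from funext fun s => (hB s).2] at h1
    exact h1.unique (hasDerivAt_const u 0)
  · have h1 := ((((h 0).pow 2).add ((h 2).pow 2)).const_mul ρ).add ((h 3).pow 2)
    have h2 := hasDerivAt_const u (1 : ℝ)
    rw [← show (fun s => ρ * (γ s 0 ^ 2 + γ s 2 ^ 2) + γ s 3 ^ 2) = fun _ => (1 : ℝ) from
      funext fun s => mem_B_eq (hB s)] at h2
    have := h1.unique h2
    norm_num at this
    linarith

theorem coord_three_of_hasDerivAt {X : ℝ → V} {X' : V} {u : ℝ} {c : ℝ} (hX : ∀ s, X s 3 = c)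
    (h : HasDerivAt X X' u) : X' 3 = 0 := by
  have h1 := (hasDerivAt_pi.1 h) 3
  rw [show (fun s => X s 3) = fun _ => c from funext hX] at h1
  exact h1.unique (hasDerivAt_const u c)

theorem conormal_eq (γ : ℝ → V) (u : ℝ) :
    conormal ρ γ u = planarCross ρ (γ u) ((speed ρ γ u)⁻¹ • deriv γ u) := by
  rw [conormal, cross_eq_planarCross, planarCross_smul]

end Calculus

/-! ### The Frenet frame of a curve in `B ρ` -/

noncomputable section

/-- The unit tangent of a curve. -/
def unitTangent (ρ : ℝ) (γ : ℝ → V) (u : ℝ) : V := (speed ρ γ u)⁻¹ • deriv γ u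

end

namespace IsPlanarClosedCurve

variable {ρ L : ℝ} {γ : ℝ → V} (hγ : IsPlanarClosedCurve ρ L γ)
include hγ

theorem deriv_contDiff : ContDiff ℝ ∞ (deriv γ) :=
  ((contDiff_infty_iff_deriv).1 hγ.smooth).2

theorem hasDerivAt' (u : ℝ) : HasDerivAt γ (deriv γ u) u :=
  (hγ.smooth.differentiable (by simp) u).hasDerivAt

theorem hasDerivAt_deriv (u : ℝ) : HasDerivAt (deriv γ) (deriv (deriv γ) u) u :=
  (hγ.deriv_contDiff.differentiable (by simp) u).hasDerivAt

theorem isTangent_deriv (u : ℝ) : IsTangent ρ (γ u) (deriv γ u) :=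
  isTangent_of_hasDerivAt hγ.planar (hγ.hasDerivAt' u)

theorem ip_deriv_pos (u : ℝ) : 0 < ip ρ (deriv γ u) (deriv γ u) :=
  Real.sqrt_pos.1 (hγ.regular u)

theorem speed_sq (u : ℝ) : speed ρ γ u ^ 2 = ip ρ (deriv γ u) (deriv γ u) :=
  Real.sq_sqrt (hγ.ip_deriv_pos u).le

theorem speed_contDiff : ContDiff ℝ ∞ (speed ρ γ) :=
  (ip_contDiff hγ.deriv_contDiff hγ.deriv_contDiff).sqrt fun u => (hγ.ip_deriv_pos u).ne'

theorem unitTangent_contDiff : ContDiff ℝ ∞ (unitTangent ρ γ) :=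
  (hγ.speed_contDiff.inv fun u => (hγ.regular u).ne').smul hγ.deriv_contDiff

theorem conormal_contDiff : ContDiff ℝ ∞ (conormal ρ γ) := by
  rw [show conormal ρ γ = _ from funext (conormal_eq γ)]
  exact planarCross_contDiff hγ.smooth hγ.unitTangent_contDiff

theorem curvature_contDiff : ContDiff ℝ ∞ (curvature ρ γ) :=
  (ip_contDiff ((contDiff_infty_iff_deriv).1 hγ.deriv_contDiff).2 hγ.conormal_contDiff).div
    (hγ.speed_contDiff.pow 2) fun u => (pow_pos (hγ.regular u) 2).ne'

theorem isTangent_unitTangent (u : ℝ) : IsTangent ρ (γ u) (unitTangent ρ γ u) :=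
  (hγ.isTangent_deriv u).smul _

omit hγ in
theorem conormal_eq' (u : ℝ) : conormal ρ γ u = planarCross ρ (γ u) (unitTangent ρ γ u) :=
  conormal_eq γ u

omit hγ in
theorem isTangent_conormal (u : ℝ) : IsTangent ρ (γ u) (conormal ρ γ u) := by
  rw [conormal_eq']; exact IsTangent.planarCross _ _

theorem ip_tangent_tangent (u : ℝ) : ip ρ (unitTangent ρ γ u) (unitTangent ρ γ u) = 1 := by
  have := hγ.regular u
  rw [unitTangent, ip_smul_left, ip_smul_right, ← hγ.speed_sq]
  field_simp

theorem ip_conormal_conormal (u : ℝ) : ip ρ (conormal ρ γ u) (conormal ρ γ u) = 1 := by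
  rw [conormal_eq', (hγ.isTangent_unitTangent u).ip_planarCross_planarCross (hγ.planar u),
    hγ.ip_tangent_tangent]

theorem ip_tangent_conormal (u : ℝ) : ip ρ (unitTangent ρ γ u) (conormal ρ γ u) = 0 := by
  rw [conormal_eq', (hγ.isTangent_unitTangent u).ip_self_planarCross (hγ.planar u)]

theorem planarCross_conormal (u : ℝ) :
    planarCross ρ (γ u) (conormal ρ γ u) = -unitTangent ρ γ u := by
  rw [conormal_eq', (hγ.isTangent_unitTangent u).planarCross_planarCross (hγ.planar u)]

theorem planarCross_tangent_conormal (u : ℝ) :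
    planarCross ρ (unitTangent ρ γ u) (conormal ρ γ u) = ρ • γ u := by
  rw [conormal_eq', (hγ.isTangent_unitTangent u).planarCross_frame (hγ.planar u)
    (hγ.ip_tangent_tangent u)]

theorem deriv_eq (u : ℝ) : deriv γ u = speed ρ γ u • unitTangent ρ γ u := by
  rw [unitTangent, smul_inv_smul₀ (hγ.regular u).ne']

theorem hasDerivAt (u : ℝ) : HasDerivAt γ (speed ρ γ u • unitTangent ρ γ u) u := by
  rw [← hγ.deriv_eq]; exact hγ.hasDerivAt' u

/-- Second derivative in terms of the derivative of the unit tangent. -/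
theorem deriv_deriv_eq_of_hasDerivAt {T' : V} {u : ℝ} (h : HasDerivAt (unitTangent ρ γ) T' u) :
    deriv (deriv γ) u = speed ρ γ u • T' + deriv (speed ρ γ) u • unitTangent ρ γ u := by
  rw [show deriv γ = fun s => speed ρ γ s • unitTangent ρ γ s from funext hγ.deriv_eq]
  exact ((hγ.speed_contDiff.differentiable (by simp) u).hasDerivAt.smul h).deriv

/-- Frenet equation for the unit tangent. -/
theorem hasDerivAt_unitTangent (u : ℝ) :
    HasDerivAt (unitTangent ρ γ)
      (speed ρ γ u • (curvature ρ γ u • conormal ρ γ u - ρ • γ u)) u := by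
  have h := (hγ.unitTangent_contDiff.differentiable (by simp) u).hasDerivAt
  set T' := deriv (unitTangent ρ γ) u
  have hv := hγ.regular u
  have hTT := hγ.ip_tangent_tangent u
  have hT := hγ.isTangent_unitTangent u
  have hp := hγ.planar u
  have ht1 : T' 1 = 0 := by
    have h1 := hasDerivAt_pi.1 h 1
    rw [show (fun s => unitTangent ρ γ s 1) = fun _ => (0 : ℝ) from
      funext fun s => (hγ.isTangent_unitTangent s).1] at h1
    exact h1.unique (hasDerivAt_const u 0)
  -- The ambient derivative of `T` leaves the tangent plane. Differentiating the tangency equation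
  -- of `T` shows that its part along the position is `-v ρ γ`; adding this back gives the covariant
  -- derivative.
  have htan : IsTangent ρ (γ u) (T' + (speed ρ γ u * ρ) • γ u) := by
    refine ⟨by simp [ht1, hp.2], ?_⟩
    have hg := hasDerivAt_pi.1 (hγ.hasDerivAt u)
    have ht := hasDerivAt_pi.1 h
    have e := ((((hg 0).mul (ht 0)).add ((hg 2).mul (ht 2))).const_mul ρ).add ((hg 3).mul (ht 3))
    have e2 := hasDerivAt_const u (0 : ℝ)
    rw [← show (fun s => ρ * (γ s 0 * unitTangent ρ γ s 0 + γ s 2 * unitTangent ρ γ s 2)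
      + γ s 3 * unitTangent ρ γ s 3) = fun _ => (0 : ℝ) from
      funext fun s => (hγ.isTangent_unitTangent s).2] at e2
    have e3 := e.unique e2
    have hB := mem_B_eq hp
    obtain ⟨c, hc, -⟩ := hT.exists_coord hp
    rw [IsTangent.ip_eq hT.1 hc hc] at hTT
    simp only [Pi.smul_apply, smul_eq_mul, Pi.add_apply] at e3 ⊢
    rw [hc] at e3
    linear_combination e3 + speed ρ γ u * ρ * hB - speed ρ γ u * ρ * hTT
  have hip : ip ρ T' (unitTangent ρ γ u) = 0 := by
    have e := ip_hasDerivAt (ρ := ρ) h h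
    rw [show (fun s => ip ρ (unitTangent ρ γ s) (unitTangent ρ γ s)) = fun _ => (1 : ℝ) from
      funext hγ.ip_tangent_tangent] at e
    have := e.unique (hasDerivAt_const u 1)
    rw [ip_comm (unitTangent ρ γ u)] at this
    linarith
  have hk : ip ρ T' (conormal ρ γ u) = speed ρ γ u * curvature ρ γ u := by
    rw [curvature, hγ.deriv_deriv_eq_of_hasDerivAt h, ip_add_left, ip_smul_left, ip_smul_left,
      hγ.ip_tangent_conormal]
    field_simp
    ring
  have e := htan.eq_frame hp hT hTT
  rw [← conormal_eq', ip_add_left, ip_add_left, ip_smul_left, ip_smul_left, hip, hk, mul_assoc,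
    mul_assoc, hT.mul_ip_self, (isTangent_conormal u).mul_ip_self] at e
  rw [show speed ρ γ u • (curvature ρ γ u • conormal ρ γ u - ρ • γ u) = T' by
    rw [eq_sub_of_add_eq e]; module]
  exact h

/-- Frenet equation for the unit normal. -/
theorem hasDerivAt_conormal (u : ℝ) :
    HasDerivAt (conormal ρ γ) (-(speed ρ γ u * curvature ρ γ u) • unitTangent ρ γ u) u := by
  have h := planarCross_hasDerivAt (ρ := ρ) (hγ.hasDerivAt u) (hγ.hasDerivAt_unitTangent u)
  rw [← show conormal ρ γ = fun s => planarCross ρ (γ s) (unitTangent ρ γ s) from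
    funext (conormal_eq γ)] at h
  convert! h using 1
  rw [planarCross_smul_left, planarCross_self, planarCross_smul, planarCross_sub, planarCross_smul,
    planarCross_smul, planarCross_self, hγ.planarCross_conormal]
  module

theorem deriv_deriv_eq (u : ℝ) :
    deriv (deriv γ) u = (speed ρ γ u ^ 2 * curvature ρ γ u) • conormal ρ γ u
      - (speed ρ γ u ^ 2 * ρ) • γ u + deriv (speed ρ γ) u • unitTangent ρ γ u := by
  rw [hγ.deriv_deriv_eq_of_hasDerivAt (hγ.hasDerivAt_unitTangent u)]
  module

end IsPlanarClosedCurve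
-- Slices of smooth maps and integrals depending on a parameter
section PartialDerivatives

variable {E : Type*} [NormedAddCommGroup E] [NormedSpace ℝ E] {Γ : ℝ × ℝ → E}

theorem contDiff_fderiv_apply (h : ContDiff ℝ ∞ Γ) (e : ℝ × ℝ) :
    ContDiff ℝ ∞ (fun q => fderiv ℝ Γ q e) :=
  (h.fderiv_right (m := ∞) (by simp)).clm_apply contDiff_const

theorem hasDerivAt_slice_left (h : ContDiff ℝ ∞ Γ) (ε u : ℝ) :
    HasDerivAt (fun s => Γ (s, u)) (fderiv ℝ Γ (ε, u) (1, 0)) ε :=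
  ((h.differentiable (by simp) (ε, u)).hasFDerivAt).comp_hasDerivAt ε
    ((hasDerivAt_id ε).prodMk (hasDerivAt_const ε u))

theorem hasDerivAt_slice_right (h : ContDiff ℝ ∞ Γ) (ε u : ℝ) :
    HasDerivAt (fun s => Γ (ε, s)) (fderiv ℝ Γ (ε, u) (0, 1)) u :=
  ((h.differentiable (by simp) (ε, u)).hasFDerivAt).comp_hasDerivAt u
    ((hasDerivAt_const u ε).prodMk (hasDerivAt_id u))

theorem fderiv_fderiv_apply_comm (h : ContDiff ℝ ∞ Γ) (q e e' : ℝ × ℝ) :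
    fderiv ℝ (fun p => fderiv ℝ Γ p e) q e' = fderiv ℝ (fun p => fderiv ℝ Γ p e') q e := by
  have hd : DifferentiableAt ℝ (fderiv ℝ Γ) q :=
    (h.fderiv_right (m := ∞) (by simp)).differentiable (by simp) q
  have hs : IsSymmSndFDerivAt ℝ Γ q :=
    h.contDiffAt.isSymmSndFDerivAt (by simp only [minSmoothness_of_isRCLikeNormedField]; exact WithTop.coe_le_coe.2 le_top)
  rw [fderiv_clm_apply hd (differentiableAt_const e), fderiv_clm_apply hd (differentiableAt_const e')]
  simpa using hs e' e

/-- Differentiation under the integral sign for an integrand that is continuously differentiable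
near the segment of integration. -/
theorem hasDerivAt_integral_of_contDiffOn {F : ℝ × ℝ → ℝ} {U : Set (ℝ × ℝ)} (hU : IsOpen U)
    (hF : ContDiffOn ℝ 1 F U) {a b : ℝ} (hab : a ≤ b) {ε₀ : ℝ}
    (hsub : ∀ u ∈ Set.Icc a b, (ε₀, u) ∈ U) :
    HasDerivAt (fun ε => ∫ u in a..b, F (ε, u)) (∫ u in a..b, fderiv ℝ F (ε₀, u) (1, 0)) ε₀ := by
  -- The tube lemma provides a compact box inside `U`, on which the continuous derivative is
  -- bounded; the bound is the dominating constant.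
  obtain ⟨A, A', hA, -, h0, hK, hAK⟩ := generalized_tube_lemma (isCompact_singleton (x := ε₀))
    (isCompact_Icc (a := a) (b := b)) hU (by rintro ⟨x, u⟩ ⟨rfl, hu⟩; exact hsub u hu)
  obtain ⟨δ, hδ, hball⟩ := Metric.isOpen_iff.1 hA ε₀ (h0 rfl)
  have hmem : ∀ x ∈ Metric.closedBall ε₀ (δ / 2), ∀ u ∈ Set.Icc a b, (x, u) ∈ U := fun x hx u hu =>
    hAK ⟨hball (Metric.closedBall_subset_ball (by linarith) hx), hK hu⟩
  have hd : ContinuousOn (fun q => fderiv ℝ F q (1, 0)) U :=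
    (hF.continuousOn_fderiv_of_isOpen hU le_rfl).clm_apply continuousOn_const
  have hcomp : IsCompact (Metric.closedBall ε₀ (δ / 2) ×ˢ Set.Icc a b) :=
    (isCompact_closedBall _ _).prod isCompact_Icc
  obtain ⟨C, hC⟩ := hcomp.exists_bound_of_continuousOn
    (hd.mono (by rintro ⟨x, u⟩ ⟨hx, hu⟩; exact hmem x hx u hu))
  have hslice : ∀ {g : ℝ × ℝ → ℝ}, ContinuousOn g U → ∀ x ∈ Metric.closedBall ε₀ (δ / 2),
      ContinuousOn (fun u => g (x, u)) (Set.uIcc a b) := by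
    intro g hg x hx
    rw [Set.uIcc_of_le hab]
    exact hg.comp (by fun_prop) fun u hu => hmem x hx u hu
  have hmeas : ∀ {g : ℝ → ℝ}, ContinuousOn g (Set.uIcc a b) →
      MeasureTheory.AEStronglyMeasurable g (MeasureTheory.volume.restrict (Set.uIoc a b)) :=
    fun hg => (hg.mono Set.uIoc_subset_uIcc).aestronglyMeasurable measurableSet_uIoc
  have hε : ε₀ ∈ Metric.closedBall ε₀ (δ / 2) := Metric.mem_closedBall_self (by linarith)
  have hIcc : ∀ {u}, u ∈ Set.uIoc a b → u ∈ Set.Icc a b := fun hu => by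
    rw [← Set.uIcc_of_le hab]; exact Set.uIoc_subset_uIcc hu
  refine (intervalIntegral.hasDerivAt_integral_of_dominated_loc_of_deriv_le
    (F := fun ε u => F (ε, u)) (F' := fun ε u => fderiv ℝ F (ε, u) (1, 0)) (bound := fun _ => C)
    (Metric.ball_mem_nhds ε₀ (half_pos hδ)) ?_ ?_ ?_ ?_ ?_ ?_).2
  · filter_upwards [Metric.closedBall_mem_nhds ε₀ (half_pos hδ)] with x hx
    exact hmeas (hslice hF.continuousOn x hx)
  · exact (hslice hF.continuousOn ε₀ hε).intervalIntegrable
  · exact hmeas (hslice hd ε₀ hε)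
  · exact Filter.Eventually.of_forall fun u hu x hx =>
      hC (x, u) ⟨Metric.ball_subset_closedBall hx, hIcc hu⟩
  · exact intervalIntegrable_const
  · refine Filter.Eventually.of_forall fun u hu x hx => ?_
    have hxu := hmem x (Metric.ball_subset_closedBall hx) u (hIcc hu)
    have := ((hF.contDiffAt (hU.mem_nhds hxu)).differentiableAt (by simp)).hasFDerivAt
    exact this.comp_hasDerivAt x ((hasDerivAt_id x).prodMk (hasDerivAt_const x u))

/-- A variation field vanishes outside `(a, b)`, so one-sided derivatives show that its derivative
vanishes at the endpoints as well, which removes the boundary terms. -/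
theorem eq_zero_of_hasDerivAt_of_Iic {g : ℝ → E} {g' : E} {a : ℝ} (h : HasDerivAt g g' a)
    (h0 : ∀ u ≤ a, g u = 0) : g' = 0 := by
  have h1 : HasDerivWithinAt g 0 (Set.Iic a) a :=
    (hasDerivWithinAt_const a (Set.Iic a) (0 : E)).congr h0 (h0 a le_rfl)
  exact (uniqueDiffWithinAt_Iic a).eq_deriv _ h.hasDerivWithinAt h1

theorem eq_zero_of_hasDerivAt_of_Ici {g : ℝ → E} {g' : E} {a : ℝ} (h : HasDerivAt g g' a)
    (h0 : ∀ u, a ≤ u → g u = 0) : g' = 0 := by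
  have h1 : HasDerivWithinAt g 0 (Set.Ici a) a :=
    (hasDerivWithinAt_const a (Set.Ici a) (0 : E)).congr h0 (h0 a le_rfl)
  exact (uniqueDiffWithinAt_Ici a).eq_deriv _ h.hasDerivWithinAt h1

end PartialDerivatives

/-! ### First variation of the curvature energy -/

section Curvature

variable {ρ : ℝ}

/-- The curvature in terms of the first two derivatives of the curve. -/
theorem curvature_eq (γ : ℝ → V) (u : ℝ) :
    curvature ρ γ u = ip ρ (deriv (deriv γ) u) (planarCross ρ (γ u) (deriv γ u))
      / Real.sqrt (ip ρ (deriv γ u) (deriv γ u)) ^ 3 := by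
  rw [curvature, conormal_eq, planarCross_smul, ip_smul_right, speed]
  field_simp

/-- The Euler-Lagrange equation in the form of a Killing field with components `α, τ, β`
along the curve implies criticality. -/
theorem IsPlanarClosedCurve.isCriticalArc {L : ℝ} {γ : ℝ → V} (hγ : IsPlanarClosedCurve ρ L γ)
    {a b : ℝ} (hab : a < b) {P : ℝ → ℝ} {J : Set ℝ} (hJ : IsOpen J) (hP : ContDiffOn ℝ ∞ P J)
    (hκ : ∀ u ∈ Set.Icc a b, curvature ρ γ u ∈ J) {α β τ : ℝ → ℝ} (hα : ContDiff ℝ ∞ α)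
    (hβ : ContDiff ℝ ∞ β) (hτ : ContDiff ℝ ∞ τ)
    (hα' : ∀ u, HasDerivAt α (speed ρ γ u * τ u) u)
    (hτ' : ∀ u, HasDerivAt τ (speed ρ γ u * (curvature ρ γ u * β u - ρ * α u)) u)
    (hβ' : ∀ u, HasDerivAt β (-(speed ρ γ u * curvature ρ γ u * τ u)) u)
    (hP0 : ∀ u ∈ Set.Icc a b, P (curvature ρ γ u) = β u + curvature ρ γ u * α u)
    (hP1 : ∀ u ∈ Set.Icc a b, HasDerivAt P (α u) (curvature ρ γ u)) :
    IsCriticalArc ρ P γ a b := by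
  intro Γ hΓ
  have hs := hΓ.smooth
  obtain rfl : (fun u => Γ (0, u)) = γ := funext hΓ.zero
  set γ : ℝ → V := fun u => Γ (0, u) with hγdef
  -- partial derivatives of the variation
  set Γ₁ : ℝ × ℝ → V := fun q => fderiv ℝ Γ q (0, 1) with hΓ₁
  set Γ₂ : ℝ × ℝ → V := fun q => fderiv ℝ Γ₁ q (0, 1) with hΓ₂
  have hs1 : ContDiff ℝ ∞ Γ₁ := contDiff_fderiv_apply hs _
  have hs2 : ContDiff ℝ ∞ Γ₂ := contDiff_fderiv_apply hs1 _
  have hd1 : ∀ ε, deriv (fun u => Γ (ε, u)) = fun u => Γ₁ (ε, u) := fun ε =>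
    funext fun u => (hasDerivAt_slice_right hs ε u).deriv
  have hd2 : ∀ ε, deriv (fun u => Γ₁ (ε, u)) = fun u => Γ₂ (ε, u) := fun ε =>
    funext fun u => (hasDerivAt_slice_right hs1 ε u).deriv
  have hγ1 : deriv γ = fun u => Γ₁ (0, u) := hd1 0
  have hγ2 : deriv (deriv γ) = fun u => Γ₂ (0, u) := by rw [hγ1]; exact hd2 0
  -- the variation field
  set X : ℝ → V := fun u => fderiv ℝ Γ (0, u) (1, 0) with hX
  set X₁ : ℝ → V := fun u => fderiv ℝ Γ₁ (0, u) (1, 0) with hX₁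
  set X₂ : ℝ → V := fun u => fderiv ℝ Γ₂ (0, u) (1, 0) with hX₂
  have hXs : ContDiff ℝ ∞ X := (contDiff_fderiv_apply hs (1, 0)).comp (by fun_prop)
  have hX₁s : ContDiff ℝ ∞ X₁ := (contDiff_fderiv_apply hs1 (1, 0)).comp (by fun_prop)
  have hX' : ∀ u, HasDerivAt X (X₁ u) u := fun u => by
    have := hasDerivAt_slice_right (contDiff_fderiv_apply hs (1, 0)) 0 u
    rwa [fderiv_fderiv_apply_comm hs] at this
  have hX₁' : ∀ u, HasDerivAt X₁ (X₂ u) u := fun u => by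
    have := hasDerivAt_slice_right (contDiff_fderiv_apply hs1 (1, 0)) 0 u
    rwa [fderiv_fderiv_apply_comm hs1] at this
  have hXtan : ∀ u, IsTangent ρ (γ u) (X u) := fun u =>
    isTangent_of_hasDerivAt (γ := fun ε => Γ (ε, u)) (fun ε => hΓ.mem (ε, u))
      (hasDerivAt_slice_left hs 0 u)
  have hX0 : ∀ u, u ∉ Set.Ioo a b → X u = 0 := fun u hu => by
    have h1 := hasDerivAt_slice_left hs 0 u
    rw [show (fun ε => Γ (ε, u)) = fun _ => γ u from funext fun ε => hΓ.fixed ε u hu] at h1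
    exact h1.unique (hasDerivAt_const _ _)
  -- the integrand
  set S : ℝ × ℝ → ℝ := fun q => ip ρ (Γ₁ q) (Γ₁ q) with hS
  set D : ℝ × ℝ → ℝ := fun q => ip ρ (Γ₂ q) (planarCross ρ (Γ q) (Γ₁ q)) with hD
  have hSs : ContDiff ℝ ∞ S := ip_contDiff hs1 hs1
  have hDs : ContDiff ℝ ∞ D := ip_contDiff hs2 (planarCross_contDiff hs hs1)
  set F : ℝ × ℝ → ℝ := fun q => P (D q / Real.sqrt (S q) ^ 3) * Real.sqrt (S q) with hF
  have hE : (fun ε => energy ρ P (fun u => Γ (ε, u)) a b) = fun ε => ∫ u in a..b, F (ε, u) := by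
    funext ε
    simp only [energy, curvature_eq, speed, hd1, hd2, hF, hD, hS]
  have hSv : ∀ u, Real.sqrt (S (0, u)) = speed ρ γ u := fun u => by
    simp only [speed, hγ1, hS]
  have hDk : ∀ u, D (0, u) / Real.sqrt (S (0, u)) ^ 3 = curvature ρ γ u := fun u => by
    rw [curvature_eq, hγ2, hγ1]
  have hSpos : ∀ u, 0 < S (0, u) := fun u => by
    have := hγ.ip_deriv_pos u
    rwa [hγ1] at this
  -- The varied curves need not stay regular, nor their curvature in `J`, for large `ε`; the
  -- integrand is known to be smooth only on this open set.
  set U : Set (ℝ × ℝ) := {q | 0 < S q} ∩ (fun q => D q / Real.sqrt (S q) ^ 3) ⁻¹' J with hUdef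
  have hSopen : IsOpen {q | 0 < S q} := isOpen_lt continuous_const hSs.continuous
  have hsq : ContDiffOn ℝ ∞ (fun q => Real.sqrt (S q)) {q | 0 < S q} :=
    hSs.contDiffOn.sqrt fun q hq => (Set.mem_ofPred.1 hq).ne'
  have hk : ContDiffOn ℝ ∞ (fun q => D q / Real.sqrt (S q) ^ 3) {q | 0 < S q} :=
    hDs.contDiffOn.div (hsq.pow 3) fun q hq => (pow_pos (Real.sqrt_pos.2 hq) 3).ne'
  have hU : IsOpen U := hk.continuousOn.isOpen_inter_preimage hSopen hJ
  have hFU : ContDiffOn ℝ ∞ F U :=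
    (hP.comp (hk.mono Set.inter_subset_left) fun q hq => hq.2).mul (hsq.mono Set.inter_subset_left)
  have hsub : ∀ u ∈ Set.Icc a b, ((0 : ℝ), u) ∈ U := fun u hu =>
    ⟨hSpos u, by rw [Set.mem_preimage, hDk]; exact hκ u hu⟩
  have hder := hasDerivAt_integral_of_contDiffOn hU (hFU.of_le (by simp)) hab.le hsub
  rw [hE]
  -- the primitive of the first variation
  set T := unitTangent ρ γ with hT
  set N := conormal ρ γ with hN
  set v := speed ρ γ with hv
  set κ := curvature ρ γ with hκdef
  -- This is the boundary term left by integrating the first variation by parts. The linear system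
  -- for `α, τ, β` makes the remaining integrand vanish.
  set G : ℝ → ℝ := fun u => α u * (ip ρ (X₁ u) (N u) / v u) - τ u * ip ρ (X u) (N u)
    + β u * ip ρ (X u) (T u) with hG
  have hvs : ContDiff ℝ ∞ v := hγ.speed_contDiff
  have hvpos : ∀ u, 0 < v u := hγ.regular
  have hGs : ContDiff ℝ ∞ G :=
    ((hα.mul ((ip_contDiff hX₁s hγ.conormal_contDiff).div hvs fun u => (hvpos u).ne')).sub
      (hτ.mul (ip_contDiff hXs hγ.conormal_contDiff))).add
      (hβ.mul (ip_contDiff hXs hγ.unitTangent_contDiff))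
  have hG' : ∀ u, deriv G u = α u * (ip ρ (X₂ u) (N u) / v u + ρ * v u * ip ρ (X u) (N u)
      - deriv v u * ip ρ (X₁ u) (N u) / v u ^ 2 - κ u * ip ρ (X₁ u) (T u))
      + β u * ip ρ (X₁ u) (T u) := fun u => by
    have hNd := hγ.hasDerivAt_conormal u
    have hTd := hγ.hasDerivAt_unitTangent u
    have hvd := (hvs.differentiable (by simp) u).hasDerivAt
    have hvne := (hvpos u).ne'
    have h := (((hα' u).mul ((ip_hasDerivAt (ρ := ρ) (hX₁' u) hNd).div hvd hvne)).sub
      ((hτ' u).mul (ip_hasDerivAt (ρ := ρ) (hX' u) hNd))).add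
      ((hβ' u).mul (ip_hasDerivAt (ρ := ρ) (hX' u) hTd))
    have h2 : deriv G u = _ := h.deriv
    have h3 := (hXtan u).mul_ip_self
    rw [ip_comm] at h3
    rw [h2]
    simp only [Pi.div_apply, ip_smul_right, ip_sub_right, h3, ← hT, ← hN, ← hv, ← hκdef]
    field_simp
    ring
  -- The `ε`-derivatives of speed and curvature are expressed in the Frenet frame; `P = β + κ α` and
  -- `Ṗ = α` then turn the derivative of the integrand into `G'`.
  have key : ∀ u ∈ Set.Icc a b, fderiv ℝ F (0, u) (1, 0) = deriv G u := fun u hu => by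
    have hvne := (hvpos u).ne'
    have hp := hγ.planar u
    have hF1 : HasDerivAt (fun ε => F (ε, u)) (fderiv ℝ F (0, u) (1, 0)) 0 := by
      have h := ((hFU.contDiffAt (hU.mem_nhds (hsub u hu))).differentiableAt (by simp)).hasFDerivAt
      exact h.comp_hasDerivAt (0 : ℝ) ((hasDerivAt_id (0 : ℝ)).prodMk (hasDerivAt_const (0 : ℝ) u))
    have d0 := hasDerivAt_slice_left hs 0 u
    have d1 := hasDerivAt_slice_left hs1 0 u
    have d2 := hasDerivAt_slice_left hs2 0 u
    have g1 : Γ₁ (0, u) = v u • T u := by rw [← hγ.deriv_eq, hγ1]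
    have g2 : Γ₂ (0, u) = (v u ^ 2 * κ u) • N u - (v u ^ 2 * ρ) • γ u + deriv v u • T u := by
      rw [← hγ.deriv_deriv_eq, hγ2]
    -- for `ρ = 0` the last coordinates of the derivatives vanish
    have z0 : ρ = 0 → X u 3 = 0 := (hXtan u).coord_three hp
    have z1 : ρ = 0 → X₁ u 3 = 0 := fun h =>
      coord_three_of_hasDerivAt (fun s => (hXtan s).coord_three (hγ.planar s) h) (hX' u)
    have zγ : ρ = 0 → Γ₁ (0, u) 3 = 0 := fun h => by
      have := (hγ.isTangent_deriv u).coord_three hp h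
      rwa [hγ1] at this
    have z2 : ρ = 0 → Γ₂ (0, u) 3 = 0 := fun h => by
      have := coord_three_of_hasDerivAt
        (fun s => (hγ.isTangent_deriv s).coord_three (hγ.planar s) h) (hγ.hasDerivAt_deriv u)
      rwa [hγ2] at this
    have hs' : HasDerivAt (fun ε => Real.sqrt (S (ε, u))) (ip ρ (X₁ u) (T u)) 0 := by
      have h := (ip_hasDerivAt (ρ := ρ) d1 d1).sqrt (hSpos u).ne'
      convert! h using 1
      rw [ip_comm (Γ₁ (0, u)), hSv, g1, ip_smul_right]
      field_simp
      ring
    have hD' : HasDerivAt (fun ε => D (ε, u)) (v u * ip ρ (X₂ u) (N u)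
        + ρ * v u ^ 3 * ip ρ (X u) (N u) - deriv v u * ip ρ (X₁ u) (N u)
        + v u ^ 2 * κ u * ip ρ (X₁ u) (T u)) 0 := by
      have h := ip_hasDerivAt (ρ := ρ) d2 (planarCross_hasDerivAt (ρ := ρ) d0 d1)
      convert! h using 1
      have hTN : planarCross ρ (γ u) (T u) = N u := (conormal_eq' u).symm
      have hNT : planarCross ρ (γ u) (N u) = -T u := hγ.planarCross_conormal u
      have hTN' : planarCross ρ (T u) (N u) = ρ • γ u := hγ.planarCross_tangent_conormal u
      have hTγ : planarCross ρ (T u) (γ u) = -N u := by rw [planarCross_swap, hTN]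
      have e0 : ip ρ (Γ₂ (0, u)) (planarCross ρ (X u) (Γ₁ (0, u)))
          = ρ * v u ^ 3 * ip ρ (X u) (N u) := by
        have h3 := (hXtan u).mul_ip_self
        rw [ip_comm] at h3
        rw [planarCross_swap, ip_neg_right, ip_planarCross_swap z2 z0, neg_neg, g1, g2,
          planarCross_smul_left, planarCross_add, planarCross_sub, planarCross_smul,
          planarCross_smul, planarCross_smul, planarCross_self, hTN', hTγ]
        simp only [ip_smul_right, ip_sub_right, ip_neg_right, h3, smul_zero, add_zero]
        ring
      have e1 : ip ρ (Γ₂ (0, u)) (planarCross ρ (γ u) (X₁ u))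
          = v u ^ 2 * κ u * ip ρ (X₁ u) (T u) - deriv v u * ip ρ (X₁ u) (N u) := by
        rw [ip_planarCross_swap z2 z1, g2, planarCross_add, planarCross_sub, planarCross_smul,
          planarCross_smul, planarCross_smul, planarCross_self, hTN, hNT]
        simp only [ip_smul_right, ip_add_right, ip_neg_right, smul_zero, sub_zero]
        ring
      have e2 : ip ρ (X₂ u) (planarCross ρ (γ u) (Γ₁ (0, u))) = v u * ip ρ (X₂ u) (N u) := by
        rw [g1, planarCross_smul, hTN, ip_smul_right]
      rw [ip_add_right]
      linear_combination -e0 - e1 - e2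
    have hne : Real.sqrt (S (0, u)) ^ 3 ≠ 0 := by rw [hSv]; positivity
    have hk' := hD'.div (hs'.pow 3) hne
    have hPk : HasDerivAt P (α u) (D (0, u) / Real.sqrt (S (0, u)) ^ 3) := by
      rw [hDk]; exact hP1 u hu
    have hF2 := (hPk.comp (0 : ℝ) hk').mul hs'
    have hDv : D (0, u) = κ u * v u ^ 3 := by
      rw [← hDk, hSv]; field_simp
    rw [hF1.unique hF2, hG']
    simp only [Function.comp, Pi.div_apply, Pi.pow_apply, hSv, hDv]
    rw [mul_div_assoc, div_self (pow_ne_zero 3 hvne), mul_one, hP0 u hu]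
    field_simp
    push_cast
    ring
  have hint : ∫ u in a..b, fderiv ℝ F (0, u) (1, 0) = 0 := by
    rw [intervalIntegral.integral_congr (g := deriv G)
      (by rw [Set.uIcc_of_le hab.le]; exact key),
      intervalIntegral.integral_deriv_eq_sub (fun u _ => hGs.differentiable (by simp) u)
        ((hGs.continuous_deriv (by simp)).intervalIntegrable _ _)]
    have ha0 : ∀ u ≤ a, X u = 0 := fun u hu => hX0 u fun h => h.1.not_ge hu
    have hb0 : ∀ u, b ≤ u → X u = 0 := fun u hu => hX0 u fun h => h.2.not_ge hu
    have ha1 := eq_zero_of_hasDerivAt_of_Iic (hX' a) ha0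
    have hb1 := eq_zero_of_hasDerivAt_of_Ici (hX' b) hb0
    simp [hG, ha1, hb1, ha0 a le_rfl, hb0 b le_rfl, ip]
  rw [hint] at hder
  exact hder

end Curvature

/-! ### Rotations -/

theorem rot_zero (p : V) : rot 0 p = p := by
  ext i; fin_cases i <;> simp [rot]

theorem rot_hasDerivAt (p : V) (t : ℝ) :
    HasDerivAt (fun s => rot s p) (rot t ![-p 1, p 0, 0, 0]) t := by
  rw [hasDerivAt_pi]
  intro i
  have hc := Real.hasDerivAt_cos t
  have hs := Real.hasDerivAt_sin t
  fin_cases i <;> simp only [rot]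
  · convert! (hc.mul_const (p 0)).sub (hs.mul_const (p 1)) using 1
    simp; ring
  · convert! (hs.mul_const (p 0)).add (hc.mul_const (p 1)) using 1
    simp; ring
  · exact hasDerivAt_const t (p 2)
  · exact hasDerivAt_const t (p 3)

theorem hasDerivAt_rot {X : ℝ → V} {X' : V} {u : ℝ} (h : HasDerivAt X X' u) (t : ℝ) :
    HasDerivAt (fun s => rot t (X s)) (rot t X') u := by
  rw [hasDerivAt_pi] at h ⊢
  intro i
  fin_cases i <;> simp only [rot]
  · exact ((h 0).const_mul _).sub ((h 1).const_mul _)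
  · exact ((h 0).const_mul _).add ((h 1).const_mul _)
  · exact h 2
  · exact h 3

theorem rot_sq_add_sq (t : ℝ) (p : V) : rot t p 0 ^ 2 + rot t p 1 ^ 2 = p 0 ^ 2 + p 1 ^ 2 := by
  simp only [rot]
  simp
  linear_combination (p 0 ^ 2 + p 1 ^ 2) * Real.sin_sq_add_cos_sq t

theorem profile_eq_of_rot {f : ℝ × ℝ → V} {u u' t : ℝ} (h : f (u', 0) = rot t (f (u, 0))) :
    profile f u' = profile f u := by
  rw [profile, profile, h, rot_sq_add_sq]
  simp [rot]

/-! ### The profile curve and the principal curvatures of a rotational torus -/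

namespace IsRotationalTorus

variable {ρ : ℝ} {f : ℝ × ℝ → V} (hf : IsRotationalTorus ρ f)
include hf

theorem eq_rot (u v : ℝ) : f (u, v) = rot v (f (u, 0)) := by
  have := hf.invariant u 0 v
  rwa [zero_add] at this

theorem contDiff_section : ContDiff ℝ ∞ fun u => f (u, 0) :=
  hf.smooth.comp (by fun_prop)

theorem hasDerivAt_section (u : ℝ) :
    HasDerivAt (fun u => f (u, 0)) (deriv (fun u => f (u, 0)) u) u :=
  (hf.contDiff_section.differentiable (by simp) u).hasDerivAt

theorem hasDerivAt_deriv_section (u : ℝ) :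
    HasDerivAt (deriv fun u => f (u, 0)) (deriv (deriv fun u => f (u, 0)) u) u :=
  (((contDiff_infty_iff_deriv).1 hf.contDiff_section).2.differentiable (by simp) u).hasDerivAt

theorem pu_eq (u v : ℝ) : pu f (u, v) = rot v (deriv (fun u => f (u, 0)) u) := by
  rw [pu, show (fun s => f (s, (u, v).2)) = fun s => rot v (f (s, 0)) from
    funext fun s => hf.eq_rot s v]
  exact (hasDerivAt_rot (hf.hasDerivAt_section u) v).deriv

theorem pv_eq (u v : ℝ) : pv f (u, v) = rot v ![-f (u, 0) 1, f (u, 0) 0, 0, 0] := by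
  rw [pv, show (fun t => f ((u, v).1, t)) = fun t => rot t (f (u, 0)) from
    funext fun t => hf.eq_rot u t]
  exact (rot_hasDerivAt _ v).deriv

theorem pu_zero (u : ℝ) : pu f (u, 0) = deriv (fun u => f (u, 0)) u := by
  rw [hf.pu_eq, rot_zero]

theorem pv_zero (u : ℝ) : pv f (u, 0) = ![-f (u, 0) 1, f (u, 0) 0, 0, 0] := by
  rw [hf.pv_eq, rot_zero]

theorem pu_pu_zero (u : ℝ) : pu (pu f) (u, 0) = deriv (deriv fun u => f (u, 0)) u := by
  rw [pu, show (fun s => pu f (s, ((u, 0) : ℝ × ℝ).2)) = deriv fun u => f (u, 0) from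
    funext fun s => hf.pu_zero s]

theorem pv_pu_zero (u : ℝ) : pv (pu f) (u, 0) =
    ![-deriv (fun u => f (u, 0)) u 1, deriv (fun u => f (u, 0)) u 0, 0, 0] := by
  rw [pv, show (fun t => pu f (((u, 0) : ℝ × ℝ).1, t))
    = fun t => rot t (deriv (fun u => f (u, 0)) u) from funext fun t => hf.pu_eq u t,
    (rot_hasDerivAt _ _).deriv, rot_zero]

theorem pv_pv_zero (u : ℝ) : pv (pv f) (u, 0) = ![-f (u, 0) 0, -f (u, 0) 1, 0, 0] := by
  rw [pv, show (fun t => pv f (((u, 0) : ℝ × ℝ).1, t))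
    = fun t => rot t ![-f (u, 0) 1, f (u, 0) 0, 0, 0] from funext fun t => hf.pv_eq u t,
    (rot_hasDerivAt _ _).deriv, rot_zero]
  simp

/-- On the axis the rotation field `f_v` vanishes, which an immersion excludes. -/
theorem radius_sq_pos (u : ℝ) : 0 < f (u, 0) 0 ^ 2 + f (u, 0) 1 ^ 2 := by
  by_contra h
  have h0 : f (u, 0) 0 = 0 := by nlinarith [sq_nonneg (f (u, 0) 0), sq_nonneg (f (u, 0) 1)]
  have h1 : f (u, 0) 1 = 0 := by nlinarith [sq_nonneg (f (u, 0) 0), sq_nonneg (f (u, 0) 1)]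
  have := (hf.immersion (u, 0)).ne_zero 1
  apply this
  simp only [Matrix.cons_val_one, Matrix.cons_val_fin_one]
  rw [hf.pv_zero, h0, h1]
  ext i; fin_cases i <;> simp

theorem profile_pos (u : ℝ) : 0 < profile f u 0 := Real.sqrt_pos.2 (hf.radius_sq_pos u)

omit hf in
theorem profile_sq (u : ℝ) : profile f u 0 ^ 2 = f (u, 0) 0 ^ 2 + f (u, 0) 1 ^ 2 :=
  Real.sq_sqrt (by positivity)

theorem profile_contDiff : ContDiff ℝ ∞ (profile f) := by
  have h := hf.contDiff_section
  rw [contDiff_pi] at h ⊢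
  intro i
  fin_cases i
  · exact (((h 0).pow 2).add ((h 1).pow 2)).sqrt fun u => (hf.radius_sq_pos u).ne'
  · exact contDiff_const
  · exact h 2
  · exact h 3

theorem profile_mem (u : ℝ) : profile f u ∈ B ρ := by
  have h := hf.mem (u, 0)
  refine ⟨⟨?_, h.2⟩, rfl⟩
  rw [profile_sq]
  have := h.1
  simp only [profile]
  simp
  linarith

theorem profile_closed : ∃ L : ℝ, 0 < L ∧ ∀ u, profile f (u + L) = profile f u := by
  obtain ⟨L, hL, α, h⟩ := hf.closed
  refine ⟨L, hL, fun u => ?_⟩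
  -- The choice `v = -α` brings the translated point back to the section `v = 0`, up to a rotation.
  have h1 := h u (-α)
  rw [neg_add_cancel, hf.eq_rot u] at h1
  exact profile_eq_of_rot h1

theorem hasDerivAt_profile (u : ℝ) : HasDerivAt (profile f) (deriv (profile f) u) u :=
  (hf.profile_contDiff.differentiable (by simp) u).hasDerivAt

theorem hasDerivAt_deriv_profile (u : ℝ) :
    HasDerivAt (deriv (profile f)) (deriv (deriv (profile f)) u) u :=
  (((contDiff_infty_iff_deriv).1 hf.profile_contDiff).2.differentiable (by simp) u).hasDerivAt

theorem deriv_profile_two (u : ℝ) :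
    deriv (profile f) u 2 = deriv (fun u => f (u, 0)) u 2 :=
  (hasDerivAt_pi.1 (hf.hasDerivAt_profile u) 2).unique (hasDerivAt_pi.1 (hf.hasDerivAt_section u) 2)

theorem deriv_profile_three (u : ℝ) :
    deriv (profile f) u 3 = deriv (fun u => f (u, 0)) u 3 :=
  (hasDerivAt_pi.1 (hf.hasDerivAt_profile u) 3).unique (hasDerivAt_pi.1 (hf.hasDerivAt_section u) 3)

theorem deriv_profile_one (u : ℝ) : deriv (profile f) u 1 = 0 :=
  (isTangent_of_hasDerivAt hf.profile_mem (hf.hasDerivAt_profile u)).1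

/-- Differentiating the squared radius avoids the square root and keeps the relation polynomial. -/
theorem deriv_profile_zero (u : ℝ) :
    profile f u 0 * deriv (profile f) u 0 = f (u, 0) 0 * deriv (fun u => f (u, 0)) u 0
      + f (u, 0) 1 * deriv (fun u => f (u, 0)) u 1 := by
  have h := hasDerivAt_pi.1 (hf.hasDerivAt_section u)
  have h1 := (hasDerivAt_pi.1 (hf.hasDerivAt_profile u) 0).pow 2
  have h2 := ((h 0).pow 2).add ((h 1).pow 2)
  have := h1.unique (h2.congr_of_eventuallyEq (Filter.Eventually.of_forall profile_sq))
  norm_num at this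
  linarith

theorem deriv_deriv_profile_two (u : ℝ) :
    deriv (deriv (profile f)) u 2 = deriv (deriv fun u => f (u, 0)) u 2 :=
  (hasDerivAt_pi.1 (hf.hasDerivAt_deriv_profile u) 2).unique
    ((hasDerivAt_pi.1 (hf.hasDerivAt_deriv_section u) 2).congr_of_eventuallyEq
      (Filter.Eventually.of_forall hf.deriv_profile_two))

theorem deriv_deriv_profile_three (u : ℝ) :
    deriv (deriv (profile f)) u 3 = deriv (deriv fun u => f (u, 0)) u 3 :=
  (hasDerivAt_pi.1 (hf.hasDerivAt_deriv_profile u) 3).unique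
    ((hasDerivAt_pi.1 (hf.hasDerivAt_deriv_section u) 3).congr_of_eventuallyEq
      (Filter.Eventually.of_forall hf.deriv_profile_three))

theorem deriv_deriv_profile_zero (u : ℝ) :
    profile f u 0 * deriv (deriv (profile f)) u 0 + deriv (profile f) u 0 ^ 2
      = f (u, 0) 0 * deriv (deriv fun u => f (u, 0)) u 0
        + f (u, 0) 1 * deriv (deriv fun u => f (u, 0)) u 1
        + deriv (fun u => f (u, 0)) u 0 ^ 2 + deriv (fun u => f (u, 0)) u 1 ^ 2 := by
  have h := hasDerivAt_pi.1 (hf.hasDerivAt_section u)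
  have h' := hasDerivAt_pi.1 (hf.hasDerivAt_deriv_section u)
  have h1 := (hasDerivAt_pi.1 (hf.hasDerivAt_profile u) 0).mul
    (hasDerivAt_pi.1 (hf.hasDerivAt_deriv_profile u) 0)
  have h2 := ((h 0).mul (h' 0)).add ((h 1).mul (h' 1))
  have := h1.unique (h2.congr_of_eventuallyEq (Filter.Eventually.of_forall hf.deriv_profile_zero))
  linarith

theorem profile_regular (u : ℝ) : 0 < speed ρ (profile f) u := by
  refine Real.sqrt_pos.2 ((isTangent_of_hasDerivAt hf.profile_mem
    (hf.hasDerivAt_profile u)).ip_pos (hf.profile_mem u) fun h => ?_)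
  have e0 := hf.deriv_profile_zero u
  have e2 := hf.deriv_profile_two u
  have e3 := hf.deriv_profile_three u
  rw [h] at e0 e2 e3
  simp only [Pi.zero_apply, mul_zero] at e0 e2 e3
  have hli := hf.immersion (u, 0)
  rw [hf.pu_zero, hf.pv_zero, LinearIndependent.pair_iff] at hli
  have hr := hf.radius_sq_pos u
  -- If the profile is stationary, `f_u` is purely angular; these coefficients, cleared of the
  -- denominator `r²`, express that it is a multiple of `f_v`.
  have := hli (f (u, 0) 0 ^ 2 + f (u, 0) 1 ^ 2) (-(f (u, 0) 0 * deriv (fun u => f (u, 0)) u 1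
    - f (u, 0) 1 * deriv (fun u => f (u, 0)) u 0)) (by
      ext i
      fin_cases i <;> simp [← e2, ← e3]
      · linear_combination (-f (u, 0) 0) * e0
      · linear_combination (-f (u, 0) 1) * e0)
  exact hr.ne' this.1

theorem isPlanarClosedCurve : ∃ L : ℝ, 0 < L ∧ IsPlanarClosedCurve ρ L (profile f) := by
  obtain ⟨L, hL, h⟩ := hf.profile_closed
  exact ⟨L, hL, hf.profile_contDiff, hf.profile_mem, hf.profile_regular, h⟩

/-- The section `f (u, 0)` need not lie in `B ρ`, but its angular velocity is parallel to `f_v` and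
drops out. What remains is the conormal rotated into the half-plane of `f (u, 0)`, scaled by `r =
|f_v|` and the speed; the sign gives `η = -N`. -/
theorem cross_eq (u : ℝ) : cross ρ (f (u, 0)) (pu f (u, 0)) (pv f (u, 0)) =
    -(speed ρ (profile f) u) • ![f (u, 0) 0 * conormal ρ (profile f) u 0,
      f (u, 0) 1 * conormal ρ (profile f) u 0, profile f u 0 * conormal ρ (profile f) u 2,
      profile f u 0 * conormal ρ (profile f) u 3] := by
  have e0 := hf.deriv_profile_zero u
  have e2 := hf.deriv_profile_two u
  have e3 := hf.deriv_profile_three u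
  have hv := (hf.profile_regular u).ne'
  have hsq := profile_sq (f := f) u
  have p2 : profile f u 2 = f (u, 0) 2 := rfl
  have p3 : profile f u 3 = f (u, 0) 3 := rfl
  rw [conormal_eq, planarCross_smul, hf.pu_zero, hf.pv_zero]
  ext i
  fin_cases i <;>
    simp [cross, planarCross, Matrix.det_succ_row_zero, Fin.sum_univ_succ, Fin.succAbove, p2, p3,
      e2, e3] <;> field_simp
  · ring
  · ring
  · linear_combination (-f (u, 0) 3) * e0 + deriv (fun u => f (u, 0)) u 3 * hsq
  · linear_combination ρ * f (u, 0) 2 * e0 - ρ * deriv (fun u => f (u, 0)) u 2 * hsq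

theorem normal_eq (u : ℝ) : normal ρ f (u, 0) =
    -![f (u, 0) 0 / profile f u 0 * conormal ρ (profile f) u 0,
      f (u, 0) 1 / profile f u 0 * conormal ρ (profile f) u 0, conormal ρ (profile f) u 2,
      conormal ρ (profile f) u 3] := by
  obtain ⟨L, -, hγ⟩ := hf.isPlanarClosedCurve
  have hN := hγ.ip_conormal_conormal u
  have hN1 := (IsPlanarClosedCurve.isTangent_conormal (ρ := ρ) (γ := profile f) u).1
  have hv := hf.profile_regular u
  have hr := hf.profile_pos u
  have hsq := profile_sq (f := f) u
  rw [normal, hf.cross_eq, ip_smul_left, ip_smul_right]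
  generalize conormal ρ (profile f) u = N at *
  generalize profile f u 0 = r at *
  generalize speed ρ (profile f) u = v at *
  generalize f (u, 0) = p at *
  have h : -v * (-v * ip ρ ![p 0 * N 0, p 1 * N 0, r * N 2, r * N 3]
      ![p 0 * N 0, p 1 * N 0, r * N 2, r * N 3]) = (v * r) ^ 2 := by
    simp only [ip, hN1] at hN ⊢
    simp
    linear_combination v ^ 2 * r ^ 2 * hN - v ^ 2 * N 0 ^ 2 * hsq
  rw [h, Real.sqrt_sq (by positivity)]
  ext i
  fin_cases i <;> simp <;> field_simp

/-- The principal curvature in the direction of the orbits. -/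
theorem isKappa₂ (u : ℝ) :
    IsKappa₂ ρ f (u, 0) (conormal ρ (profile f) u 0 / profile f u 0) := by
  have hr := (hf.profile_pos u).ne'
  have hsq := profile_sq (f := f) u
  refine ⟨Or.inr one_ne_zero, ?_, ?_⟩
  · rw [hf.normal_eq, hf.pv_pu_zero, hf.pu_zero, hf.pv_zero]
    simp [ip]
    field_simp
    ring
  · rw [hf.normal_eq, hf.pv_pv_zero, hf.pv_zero]
    simp [ip]
    field_simp
    ring

/-- The principal curvature in the direction orthogonal to the orbits. -/
theorem isKappa₁ (u : ℝ) : IsKappa₁ ρ f (u, 0) (-curvature ρ (profile f) u) := by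
  have hr := (hf.profile_pos u).ne'
  have hsq := profile_sq (f := f) u
  have e0 := hf.deriv_profile_zero u
  have e1 := hf.deriv_profile_one u
  have e2 := hf.deriv_profile_two u
  have e3 := hf.deriv_profile_three u
  have k0 := hf.deriv_deriv_profile_zero u
  have k2 := hf.deriv_deriv_profile_two u
  have k3 := hf.deriv_deriv_profile_three u
  have hv := (hf.profile_regular u).ne'
  obtain ⟨L, -, hγ⟩ := hf.isPlanarClosedCurve
  have hN1 := (IsPlanarClosedCurve.isTangent_conormal (ρ := ρ) (γ := profile f) u).1
  have hκ : ip ρ (deriv (deriv (profile f)) u) (conormal ρ (profile f) u)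
      = curvature ρ (profile f) u * ip ρ (deriv (profile f) u) (deriv (profile f) u) := by
    rw [← hγ.speed_sq, curvature]
    field_simp
  rw [IsKappa₁]
  simp only [IsPrincipalVector, hf.normal_eq, hf.pu_pu_zero, hf.pv_pu_zero, hf.pv_pv_zero,
    hf.pu_zero, hf.pv_zero]
  generalize conormal ρ (profile f) u = N at *
  generalize curvature ρ (profile f) u = κ at *
  generalize deriv (deriv (profile f)) u = g'' at *
  generalize deriv (profile f) u = g' at *
  generalize profile f u 0 = r at *
  generalize deriv (deriv fun u => f (u, 0)) u = p'' at *
  generalize deriv (fun u => f (u, 0)) u = p' at *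
  generalize f (u, 0) = p at *
  -- The second coefficient removes from `f_u` its component along the orbit.
  refine ⟨1, -(p 0 * p' 1 - p 1 * p' 0) / r ^ 2, ?_, Or.inl one_ne_zero, ?_, ?_⟩
  · simp [ip]
    field_simp
    linear_combination (p 0 * p' 1 - p 1 * p' 0) * hsq
  · simp only [ip, hN1, e1, e2, e3, k2, k3] at hκ
    -- Lagrange's identity splits the velocity in the `xy`-plane into its radial and angular parts.
    have hQ : r ^ 2 * (p' 0 ^ 2 + p' 1 ^ 2)
        = (r * g' 0) ^ 2 + (p 0 * p' 1 - p 1 * p' 0) ^ 2 := by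
      linear_combination (p' 0 ^ 2 + p' 1 ^ 2) * hsq
        - (r * g' 0 + p 0 * p' 0 + p 1 * p' 1) * e0
    simp [ip]
    generalize ρ⁻¹ = q at *
    field_simp
    linear_combination (-r ^ 3) * hκ + r ^ 2 * N 0 * k0 + (N 0 + r * κ) * hQ
  · simp [ip]
    field_simp
    linear_combination (p 0 * p' 1 - p 1 * p' 0) * (N 0 + κ * r) * hsq

end IsRotationalTorus

/-! ### The density as a function of the curvature, and a critical point of `τ` -/

/-- Near a point where `κ' ≠ 0`, a smooth function `Q` with `Q' = κ' α` is a smooth function `P`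
of `κ`, and the derivative of `P` is `α`. -/
theorem exists_contDiffOn_comp_eq {κ Q : ℝ → ℝ} (hκ : ContDiff ℝ ∞ κ) (hQ : ContDiff ℝ ∞ Q)
    {α : ℝ → ℝ} (hQ' : ∀ u, HasDerivAt Q (deriv κ u * α u) u) {u₀ : ℝ} (h0 : deriv κ u₀ ≠ 0) :
    ∃ a b : ℝ, a < u₀ ∧ u₀ < b ∧ ∃ (J : Set ℝ) (P : ℝ → ℝ), IsOpen J ∧ ContDiffOn ℝ ∞ P J ∧
      ∀ u ∈ Set.Icc a b, κ u ∈ J ∧ P (κ u) = Q u ∧ HasDerivAt P (α u) (κ u) := by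
  have hd : ∀ u, HasDerivAt κ (deriv κ u) u := fun u =>
    (hκ.differentiable (by simp) u).hasDerivAt
  have hopen : IsOpen {u | deriv κ u ≠ 0} :=
    isOpen_ne_fun (hκ.continuous_deriv (by simp)) continuous_const
  -- Restricting the local inverse to `κ' ≠ 0` makes it smooth on its whole target, which serves as
  -- `J`.
  set e := (hκ.contDiffAt.toOpenPartialHomeomorph κ ((hd u₀).hasFDerivAt_equiv h0)
    (by simp : (∞ : WithTop ℕ∞) ≠ 0)).restrOpen {u | deriv κ u ≠ 0} hopen with he
  have hcoe : ∀ u, e u = κ u := fun u => rfl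
  have hsrc : e.source ∈ nhds u₀ :=
    e.open_source.mem_nhds ⟨hκ.contDiffAt.mem_toOpenPartialHomeomorph_source
      ((hd u₀).hasFDerivAt_equiv h0) (by simp), h0⟩
  have hne : ∀ u ∈ e.source, deriv κ u ≠ 0 := fun u hu => hu.2
  obtain ⟨δ, hδ, hball⟩ := Metric.nhds_basis_closedBall.mem_iff.1 hsrc
  rw [Real.closedBall_eq_Icc] at hball
  refine ⟨u₀ - δ, u₀ + δ, by linarith, by linarith, e.target, Q ∘ e.symm, e.open_target,
    fun x hx => ?_, fun u hu => ?_⟩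
  · have hx' := e.map_target hx
    have h1 := e.contDiffAt_symm_deriv (n := ∞) (hne _ hx') hx (hd _) hκ.contDiffAt
    exact (hQ.contDiffAt.comp x h1).contDiffWithinAt
  · have hu' := hball hu
    have ht : κ u ∈ e.target := e.map_source hu'
    have hl : e.symm (κ u) = u := e.left_inv hu'
    refine ⟨ht, by simp [hl], ?_⟩
    have h1 : HasDerivAt e.symm (deriv κ u)⁻¹ (κ u) :=
      e.hasDerivAt_symm ht (hne u hu') (by rw [hl]; exact hd u)
    have h2 : HasDerivAt Q (deriv κ u * α u) (e.symm (κ u)) := by rw [hl]; exact hQ' u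
    have h3 := h2.comp (κ u) h1
    convert! h3 using 1
    have := hne u hu'
    field_simp

namespace IsRotationalTorus

variable {ρ : ℝ} {f : ℝ × ℝ → V} (hf : IsRotationalTorus ρ f)
include hf

/-- A point of the profile curve at which the distance to the axis satisfies the linear equation
of geodesics: the second principal curvature there is `ρ / κ` if `κ ≠ 0`. -/
theorem exists_curvature_mul_eq : ∃ u, curvature ρ (profile f) u * conormal ρ (profile f) u 0
    = ρ * profile f u 0 := by
  obtain ⟨L, hL, hγ⟩ := hf.isPlanarClosedCurve
  have hd : ∀ u, deriv (profile f) (u + L) = deriv (profile f) u := fun u => by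
    rw [← deriv_comp_add_const, show (fun x => profile f (x + L)) = profile f from
      funext hγ.closed]
  have hT : unitTangent ρ (profile f) (0 + L) = unitTangent ρ (profile f) 0 := by
    rw [unitTangent, unitTangent, speed, speed, hd]
  -- Rolle's theorem over one period of `τ`, whose derivative is `v (κ β - ρ α)`.
  obtain ⟨u, -, hu⟩ := exists_hasDerivAt_eq_zero (f := fun u => unitTangent ρ (profile f) u 0)
    (by linarith : 0 < 0 + L)
    ((contDiff_pi.1 hγ.unitTangent_contDiff 0).continuous.continuousOn) (by simp only [hT])
    fun u _ => hasDerivAt_pi.1 (hγ.hasDerivAt_unitTangent u) 0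
  refine ⟨u, ?_⟩
  have := hγ.regular u
  simp only [Pi.smul_apply, Pi.sub_apply, smul_eq_mul, mul_eq_zero] at hu
  rcases hu with h | h
  · exact absurd h this.ne'
  · linarith

end IsRotationalTorus

end SpaceForm

/-! ### The theorem -/

theorem mainTheorem4 (ρ : ℝ) (f : ℝ × ℝ → SpaceForm.V) (hf : SpaceForm.IsRotationalTorus ρ f)
    (hni : ¬ SpaceForm.IsIsoparametric ρ f)
    (W : ℝ → ℝ → ℝ) (hW : SpaceForm.IsWeingarten ρ f W)
    (γ : ℝ → SpaceForm.V) (hγ : γ = SpaceForm.profile f)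
    (κ : ℝ → ℝ) (hκ : κ = SpaceForm.curvature ρ γ) :
    (∃ L : ℝ, 0 < L ∧ SpaceForm.IsPlanarClosedCurve ρ L γ) ∧
    ∀ u₀ : ℝ, (deriv κ u₀ ≠ 0 ∨ ∀ u, κ u = κ u₀) →
      ∃ a b : ℝ, a < u₀ ∧ u₀ < b ∧
      ∃ (J : Set ℝ) (P : ℝ → ℝ), IsOpen J ∧ (∀ u ∈ Set.Icc a b, κ u ∈ J) ∧ ContDiffOn ℝ ∞ P J ∧
        (∀ x ∈ κ '' Set.Icc a b, deriv P x ≠ 0 ∧ W (-x) (P x / deriv P x - x) = 0) ∧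
        SpaceForm.IsCriticalArc ρ P γ a b := by
  have hpos : ∀ u, 0 < γ u 0 := by rw [hγ]; exact hf.profile_pos
  have hWu : ∀ u, W (-κ u) (SpaceForm.conormal ρ γ u 0 / γ u 0) = 0 := fun u => by
    rw [hκ, hγ]
    exact hW (u, 0) _ _ (hf.isKappa₁ u) (hf.isKappa₂ u)
  have hex : ∃ u, κ u * SpaceForm.conormal ρ γ u 0 = ρ * γ u 0 := by
    rw [hκ, hγ]; exact hf.exists_curvature_mul_eq
  have hγc : ∃ L : ℝ, 0 < L ∧ SpaceForm.IsPlanarClosedCurve ρ L γ := by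
    rw [hγ]; exact hf.isPlanarClosedCurve
  refine ⟨hγc, fun u₀ hu₀ => ?_⟩
  clear hγ hW
  obtain ⟨L, -, hγ⟩ := hγc
  have hκs : ContDiff ℝ ∞ κ := by rw [hκ]; exact hγ.curvature_contDiff
  rcases hu₀ with h | h
  · have hα : ContDiff ℝ ∞ fun u => γ u 0 := contDiff_pi.1 hγ.smooth 0
    have hβ : ContDiff ℝ ∞ fun u => SpaceForm.conormal ρ γ u 0 := contDiff_pi.1 hγ.conormal_contDiff 0
    have hτ : ContDiff ℝ ∞ fun u => SpaceForm.unitTangent ρ γ u 0 :=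
      contDiff_pi.1 hγ.unitTangent_contDiff 0
    have hα' := fun u => hasDerivAt_pi.1 (hγ.hasDerivAt u) 0
    have hβ' := fun u => hasDerivAt_pi.1 (hγ.hasDerivAt_conormal u) 0
    have hτ' := fun u => hasDerivAt_pi.1 (hγ.hasDerivAt_unitTangent u) 0
    simp only [Pi.smul_apply, Pi.sub_apply, smul_eq_mul] at hα' hβ' hτ'
    -- In the derivative of `β + κ α` the terms `β'` and `κ α'` cancel, leaving `κ' α`; hence `Ṗ(κ)
    -- = α`.
    obtain ⟨a, b, ha, hb, J, P, hJ, hP, hu⟩ := SpaceForm.exists_contDiffOn_comp_eq hκs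
      (hβ.add (hκs.mul hα)) (α := fun u => γ u 0) (fun u => by
        have hκd := (hκs.differentiable (by simp) u).hasDerivAt
        convert! (hβ' u).add (hκd.mul (hα' u)) using 1
        rw [hκ]; ring) h
    refine ⟨a, b, ha, hb, J, P, hJ, fun u hx => (hu u hx).1, hP, ?_, ?_⟩
    · rintro _ ⟨u, hx, rfl⟩
      obtain ⟨-, h1, h2⟩ := hu u hx
      have hne := (hpos u).ne'
      rw [h2.deriv, h1]
      refine ⟨hne, ?_⟩
      rw [← hWu u]
      congr 1
      field_simp
      simp
    · rw [hκ] at hu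
      exact hγ.isCriticalArc (ha.trans hb) hJ hP (fun u hx => (hu u hx).1) hα hβ hτ hα' hτ'
        (fun u => by convert! hβ' u using 1; ring) (fun u hx => (hu u hx).2.1)
        fun u hx => (hu u hx).2.2
  · obtain ⟨w, hw⟩ := hex
    have hne := (hpos w).ne'
    -- This is `κ₂` at the critical point `w` of `τ`; the Weingarten relation at `w` then applies at
    -- every point because `κ` is constant.
    set μ := SpaceForm.conormal ρ γ w 0 / γ w 0 with hμ
    have hρ : ∀ u, κ u * μ = ρ := fun u => by
      rw [h u, ← h w, hμ, ← mul_div_assoc, hw]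
      field_simp
    have hPd : ∀ x, HasDerivAt (fun x : ℝ => x + μ) 1 x := fun x => (hasDerivAt_id x).add_const μ
    -- Any interval around `u₀` would do. Since `Ṗ = 1`, the constants `α = 1`, `τ = 0`, `β = μ`
    -- replace the coordinates of the frame, and the linear system reduces to `κ μ = ρ`.
    refine ⟨u₀ - 1, u₀ + 1, by linarith, by linarith, Set.univ, fun x => x + μ, isOpen_univ,
      fun _ _ => trivial, by fun_prop, ?_, ?_⟩
    · rintro _ ⟨u, -, rfl⟩
      rw [(hPd _).deriv, div_one, add_sub_cancel_left, h u, ← h w]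
      exact ⟨one_ne_zero, hWu w⟩
    · refine hγ.isCriticalArc (by linarith) isOpen_univ (by fun_prop) (fun _ _ => trivial)
        (α := fun _ => 1) (β := fun _ => μ) (τ := fun _ => 0) contDiff_const contDiff_const
        contDiff_const (fun u => ?_) (fun u => ?_) (fun u => ?_) (fun u _ => ?_) (fun u _ => hPd _)
      · simpa using hasDerivAt_const u (1 : ℝ)
      · rw [← hκ, hρ]
        simpa using hasDerivAt_const u (0 : ℝ)
      · simpa using hasDerivAt_const u μ
      · ring
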